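/- Let $K$ be an algebraically closed field, $X$ a finite set of variables, $H\subseteq K[X]$ an ideal, $T\in K[X]$ a polynomial, and $U\subseteq X$ a set of variables that is independent for $H$, i.e. $H\cap K[U]=(0)$. Let $z$ be a new variable, put $I=(H,\,Tz-1)\subseteq K[U][X\setminus U,z]$, and fix a monomial order on the variables $X\setminus U,z$. A *reduced Gröbner system* of $I$ with parameters $U$ is a finite family of pairs $(S_i,B_i)$, $1\le i\le s$, where the segments $S_i$ are nonempty constructible sets that partition the parameter space $K^U$, and each $B_i\subset K[U][X\setminus U,z]$ is a finite set of polynomials of content $1$ over $K[U]$ with pairwise distinct leading monomials, such that for every $u_0\in S_i$ the leading coefficients of the elements of $B_i$ do not vanish at $u_0$ and the elements of $B_i$, specialized at $u_0$ and made monic, form the reduced Gröbner basis of the specialization of $I$ at $u_0$. A *minimal comprehensive Gröbner system* (MCCGS) of $\{H,Tz-1\}$ with respect to $U$ is a reduced Gröbner system with the least possible number of segments. Its *generic segment* is the segment that contains a nonempty Zariski-open subset of $K^U$. A basis is said to be $1$ if it consists of a single nonzero constant (content-$1$ polynomials being determined only up to a nonzero constant factor). Then: 1. $T$ vanishes identically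 on every irreducible component $C$ of $\mathbb V(H)\subseteq K^X$ on which $U$ remains independent (i.e. no nonzero element of $K[U]$ vanishes identically on $C$) if and only if $I\cap K[U]\neq(0)$. 2. Every MCCGS of $\{H,Tz-1\}$ with respect to $U$ has exactly one generic segment, and $T$ vanishes identically on every irreducible component of $\mathbb V(H)$ on which $U$ remains independent if and only if the basis of the generic segment is $1$. -/

import Mathlib

open MvPolynomial

namespace MCCGS

/-! ### Affine algebraic sets -/

section Geometry

variable {σ K : Type*} [Field K]

/-- An algebraic subset of the affine space `K^σ`. -/
def IsAlgebraicSet (C : Set (σ → K)) : Prop :=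
  ∃ I : Ideal (MvPolynomial σ K), C = zeroLocus K I

/-- A nonempty algebraic set that is not covered by two algebraic sets unless one of them
already covers it. -/
structure IsIrreducibleAlgebraicSet (C : Set (σ → K)) : Prop where
  isAlgebraicSet : IsAlgebraicSet C
  nonempty : C.Nonempty
  subset_or_subset : ∀ I J : Ideal (MvPolynomial σ K),
    C ⊆ zeroLocus K I ∪ zeroLocus K J → C ⊆ zeroLocus K I ∨ C ⊆ zeroLocus K J

/-- `C` is an irreducible component of the algebraic set `V`. -/
def IsComponent (V C : Set (σ → K)) : Prop :=
  Maximal (fun D => IsIrreducibleAlgebraicSet D ∧ D ⊆ V) C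

/-- A constructible subset of `K^σ`: a finite union of differences of algebraic sets. -/
def IsConstructibleSet (S : Set (σ → K)) : Prop :=
  ∃ (n : ℕ) (a b : Fin n → Ideal (MvPolynomial σ K)),
    S = ⋃ j, zeroLocus K (a j) \ zeroLocus K (b j)

/-- `S` contains a nonempty Zariski-open subset of `K^σ`. -/
def ContainsOpen (S : Set (σ → K)) : Prop :=
  ∃ J : Ideal (MvPolynomial σ K), (zeroLocus K J)ᶜ.Nonempty ∧ (zeroLocus K J)ᶜ ⊆ S

/-- The variables in `U` are independent for the ideal `I`: `I ∩ K[U] = (0)`. -/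
def IndependentVars (U : Set σ) (I : Ideal (MvPolynomial σ K)) : Prop :=
  I.comap (rename ((↑) : U → σ) : MvPolynomial U K →ₐ[K] MvPolynomial σ K) = ⊥

/-- `T` vanishes identically on every irreducible component of `V(H)` on which the
variables `U` remain independent. -/
def VanishesOnIndependentComponents (U : Set σ) (H : Ideal (MvPolynomial σ K))
    (T : MvPolynomial σ K) : Prop :=
  ∀ C : Set (σ → K), IsComponent (zeroLocus K H) C →
    IndependentVars U (vanishingIdeal K C) → ∀ x ∈ C, eval x T = 0

end Geometry

/-! ### Gröbner bases over a field -/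

section Groebner

variable {ξ K : Type*} [Field K]

/-- `B` is a Gröbner basis of `I`: the leading monomial of every nonzero element of `I`
is divisible by that of a nonzero element of `B`. -/
def IsGroebnerBasis (m : MonomialOrder ξ) (I : Ideal (MvPolynomial ξ K))
    (B : Set (MvPolynomial ξ K)) : Prop :=
  B ⊆ I ∧ ∀ f ∈ I, f ≠ 0 → ∃ b ∈ B, b ≠ 0 ∧ m.degree b ≤ m.degree f

/-- `B` is the reduced Gröbner basis of `I`: its elements are monic, and no monomial of an
element is divisible by the leading monomial of another element. -/
structure IsReducedGroebnerBasis (m : MonomialOrder ξ) (I : Ideal (MvPolynomial ξ K))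
    (B : Set (MvPolynomial ξ K)) : Prop where
  isGroebnerBasis : IsGroebnerBasis m I B
  monic : ∀ b ∈ B, m.Monic b
  reduced : ∀ b ∈ B, ∀ b' ∈ B, b ≠ b' → ∀ d ∈ b.support, ¬ m.degree b' ≤ d

end Groebner

/-! ### Parametric ideals: `μ` indexes the parameters `u`, `ξ` the variables `x` -/

section Parametric

variable {μ ξ K : Type*} [Field K]

/-- The specialization `K[u][x] → K[x]` of the parameters at the point `u₀`. -/
noncomputable def specialize (u₀ : μ → K) :
    MvPolynomial ξ (MvPolynomial μ K) →+* MvPolynomial ξ K :=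
  MvPolynomial.map (eval u₀)

/-- The specialization of `b` at `u₀`, divided by the value of the leading coefficient
of `b`. -/
noncomputable def monicSpecialize (m : MonomialOrder ξ) (u₀ : μ → K)
    (b : MvPolynomial ξ (MvPolynomial μ K)) : MvPolynomial ξ K :=
  C (eval u₀ (m.leadingCoeff b))⁻¹ * specialize u₀ b

/-- `b` has content `1` with respect to `x` over `K[u]`. -/
def HasContentOne (b : MvPolynomial ξ (MvPolynomial μ K)) : Prop :=
  ∀ d : MvPolynomial μ K, (∀ e : ξ →₀ ℕ, d ∣ b.coeff e) → IsUnit d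

/-- The pairs `(S i, B i)` form a Gröbner system of the parametric ideal `I`. -/
structure IsGroebnerSystem (m : MonomialOrder ξ)
    (I : Ideal (MvPolynomial ξ (MvPolynomial μ K))) {s : ℕ}
    (S : Fin s → Set (μ → K)) (B : Fin s → Set (MvPolynomial ξ (MvPolynomial μ K))) :
    Prop where
  constructible : ∀ i, IsConstructibleSet (S i)
  finite : ∀ i, (B i).Finite
  cover : ⋃ i, S i = Set.univ
  groebner : ∀ i, ∀ u₀ ∈ S i,
    IsGroebnerBasis m (I.map (specialize u₀)) (specialize u₀ '' B i)

/-- A Gröbner system whose segments partition the parameter space and whose bases have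
content `1`, have leading coefficients without zeros on the segment (so that the leading
monomials do not change), and specialize to the reduced Gröbner basis, up to making the
specialized polynomials monic. -/
structure IsReducedGroebnerSystem (m : MonomialOrder ξ)
    (I : Ideal (MvPolynomial ξ (MvPolynomial μ K))) {s : ℕ}
    (S : Fin s → Set (μ → K)) (B : Fin s → Set (MvPolynomial ξ (MvPolynomial μ K))) :
    Prop extends IsGroebnerSystem m I S B where
  nonempty : ∀ i, (S i).Nonempty
  disjoint : Pairwise fun i j => Disjoint (S i) (S j)
  contentOne : ∀ i, ∀ b ∈ B i, HasContentOne b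
  degree_injOn : ∀ i, Set.InjOn m.degree (B i)
  leadingCoeff_ne_zero : ∀ i, ∀ u₀ ∈ S i, ∀ b ∈ B i, eval u₀ (m.leadingCoeff b) ≠ 0
  reduced : ∀ i, ∀ u₀ ∈ S i,
    IsReducedGroebnerBasis m (I.map (specialize u₀)) (monicSpecialize m u₀ '' B i)

/-- A minimal comprehensive Gröbner system of `I`: a reduced one with the least possible
number of segments. -/
structure IsMCCGS (m : MonomialOrder ξ)
    (I : Ideal (MvPolynomial ξ (MvPolynomial μ K))) {s : ℕ}
    (S : Fin s → Set (μ → K)) (B : Fin s → Set (MvPolynomial ξ (MvPolynomial μ K))) :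
    Prop extends IsReducedGroebnerSystem m I S B where
  minimal : ∀ (s' : ℕ) (S' : Fin s' → Set (μ → K))
    (B' : Fin s' → Set (MvPolynomial ξ (MvPolynomial μ K))),
    IsReducedGroebnerSystem m I S' B' → s ≤ s'

/-- The basis `B` is `1`. Content-`1` polynomials are only determined up to a nonzero
constant factor, so `B` consists of one nonzero constant. -/
def IsBasisOne (B : Set (MvPolynomial ξ (MvPolynomial μ K))) : Prop :=
  ∃ c : K, c ≠ 0 ∧ B = {C (C c)}

end Parametric

/-! ### The ideal `(H, T z - 1)` with parameters `U` -/

section Rabinowitsch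

variable {σ K : Type*} [Field K]

open Classical in
/-- The embedding `K[X] → K[U][X \ U, z]`; the new variable `z` is `X none`. -/
noncomputable def toParametric (U : Set σ) :
    MvPolynomial σ K →ₐ[K] MvPolynomial (Option ↥Uᶜ) (MvPolynomial U K) :=
  aeval fun i => if h : i ∈ U then C (X ⟨i, h⟩) else X (some ⟨i, h⟩)

/-- The ideal `(H, T z - 1)` of `K[U][X \ U, z]`. -/
noncomputable def refutationIdeal (U : Set σ) (H : Ideal (MvPolynomial σ K))
    (T : MvPolynomial σ K) : Ideal (MvPolynomial (Option ↥Uᶜ) (MvPolynomial U K)) :=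
  H.map (toParametric U) ⊔ Ideal.span {toParametric U T * X none - 1}

end Rabinowitsch

end MCCGS

namespace MCCGS

/-! ### Irreducible components and minimal primes. -/

section Geometry

variable {σ K : Type*} [Field K]

/-! Each minimal prime of `H` contains `T` or a nonzero polynomial in the parameters. Multiplying
the latter gives `f ≠ 0` in `K[U]` with `f * T` in the radical of `H`; as `T z = 1` modulo `I`, some
`f ^ n` lies in `I`. Conversely, if `T` does not vanish on an independent component, then for any `g
≠ 0` in `K[U]` neither does `T * g`. A point `x` where it is nonzero, with `z = 1 / T(x)`, is a zero
of `I` off `g = 0`, so `g` is not in `I` (`vanishesOnIndependentComponents_iff`).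

Finitely many constructible sets covering `K^U` cannot all lie in hypersurfaces, so one is generic;
nonempty open sets meet, so disjoint segments allow only one. If `f ≠ 0` lies in `I ∩ K[U]`, the
generic segment has a point with `f ≠ 0`, where `I` specializes to the unit ideal; content one then
forces the basis to be `1`. The converse uses the same points `(x, 1 / T(x))`. -/

lemma IsIrreducibleAlgebraicSet.mem_or_mem {C : Set (σ → K)}
    (hC : IsIrreducibleAlgebraicSet C) {p q : MvPolynomial σ K}
    (h : p * q ∈ vanishingIdeal K C) :
    p ∈ vanishingIdeal K C ∨ q ∈ vanishingIdeal K C := by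
  have key := hC.subset_or_subset (Ideal.span {p}) (Ideal.span {q}) (by
    intro x hx
    simpa [zeroLocus_span] using h x hx)
  simpa [zeroLocus_span, Set.subset_def] using key

/-- If `T` does not vanish on some independent component, then `V(H)` has points off `V(T)`
whose parameters avoid any given hypersurface. -/
lemma exists_mem_zeroLocus_of_not_vanishes {U : Set σ} {H : Ideal (MvPolynomial σ K)}
    {T : MvPolynomial σ K} (hT : ¬ VanishesOnIndependentComponents U H T)
    {g : MvPolynomial U K} (hg : g ≠ 0) :
    ∃ x ∈ zeroLocus K H, eval x T ≠ 0 ∧ eval (fun i : U => x i) g ≠ 0 := by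
  unfold VanishesOnIndependentComponents at hT
  push Not at hT
  obtain ⟨D, hD, hind, y, hy, hyT⟩ := hT
  by_contra! hcon
  have hmul : T * rename (↑) g ∈ vanishingIdeal K D := by
    intro x hx
    by_cases hxT : eval x T = 0
    · simp [aeval_eq_eval, hxT]
    · have := hcon x (hD.1.2 hx) hxT
      simpa [aeval_eq_eval, eval_rename, Function.comp_def, hxT] using this
  rcases hD.1.1.mem_or_mem hmul with h | h
  · exact hyT (by simpa [aeval_eq_eval] using h y hy)
  · have hmem : g ∈ (vanishingIdeal K D).comap
        (rename ((↑) : U → σ) : MvPolynomial U K →ₐ[K] MvPolynomial σ K) := h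
    rw [hind] at hmem
    exact hg hmem

variable [IsAlgClosed K] [Finite σ]

lemma isIrreducibleAlgebraicSet_zeroLocus (P : Ideal (MvPolynomial σ K)) [hP : P.IsPrime] :
    IsIrreducibleAlgebraicSet (zeroLocus K P) where
  isAlgebraicSet := ⟨P, rfl⟩
  nonempty := by
    by_contra h
    -- By the Nullstellensatz, an empty zero locus would make `P` the unit ideal.
    have hv := IsPrime.vanishingIdeal_zeroLocus (K := K) P
    rw [Set.not_nonempty_iff_eq_empty.mp h, vanishingIdeal_empty] at hv
    exact hP.ne_top hv.symm
  subset_or_subset I J h := by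
    have hIJ : I * J ≤ P := by
      rw [← IsPrime.vanishingIdeal_zeroLocus (K := K) P, Ideal.mul_le]
      intro p hp q hq x hx
      rcases h hx with hI | hJ
      · simp [map_mul, hI p hp]
      · simp [map_mul, hJ q hq]
    exact (hP.mul_le.mp hIJ).imp (fun h => zeroLocus_anti_mono h) (fun h => zeroLocus_anti_mono h)

/-- A larger irreducible set in `V(H)` has a prime vanishing ideal between `H` and `P`, which
minimality forces to be `P`. -/
lemma isComponent_zeroLocus_of_mem_minimalPrimes {H P : Ideal (MvPolynomial σ K)}
    (hP : P ∈ H.minimalPrimes) : IsComponent (zeroLocus K H) (zeroLocus K P) := by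
  have := hP.1.1
  refine ⟨⟨isIrreducibleAlgebraicSet_zeroLocus P, zeroLocus_anti_mono hP.1.2⟩, ?_⟩
  rintro D ⟨hD, hDH⟩ hPD
  have hprime : (vanishingIdeal K D).IsPrime :=
    ⟨fun h => by
      obtain ⟨x, hx⟩ := hD.nonempty
      have h1 : (1 : MvPolynomial σ K) ∈ vanishingIdeal K D := h ▸ Submodule.mem_top
      simpa using h1 x hx, fun h => hD.mem_or_mem h⟩
  have hle : vanishingIdeal K D ≤ P := by
    rw [← IsPrime.vanishingIdeal_zeroLocus (K := K) P]
    exact vanishingIdeal_anti_mono hPD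
  exact le_zeroLocus_iff_le_vanishingIdeal.mpr
    (hP.2 ⟨hprime, le_zeroLocus_iff_le_vanishingIdeal.mp hDH⟩ hle)

/-- If `T` vanishes on the independent components, then a nonzero multiple of `T` by a
polynomial in the parameters vanishes on all of `V(H)`. -/
lemma VanishesOnIndependentComponents.exists_mul_mem_radical {U : Set σ}
    {H : Ideal (MvPolynomial σ K)} {T : MvPolynomial σ K}
    (hT : VanishesOnIndependentComponents U H T) :
    ∃ f : MvPolynomial U K, f ≠ 0 ∧ rename (↑) f * T ∈ H.radical := by
  classical
  have hfin := H.finite_minimalPrimes_of_isNoetherianRing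
  have hex : ∀ P ∈ H.minimalPrimes, ∃ f : MvPolynomial U K, f ≠ 0 ∧ rename (↑) f * T ∈ P := by
    intro P hP
    have := hP.1.1
    by_cases hind : IndependentVars U P
    · refine ⟨1, one_ne_zero, P.mul_mem_left _ ?_⟩
      rw [← IsPrime.vanishingIdeal_zeroLocus (K := K) P]
      intro x hx
      rw [aeval_eq_eval]
      exact hT _ (isComponent_zeroLocus_of_mem_minimalPrimes hP)
        (by rwa [IsPrime.vanishingIdeal_zeroLocus]) x hx
    · obtain ⟨f, hf, hf0⟩ := Submodule.exists_mem_ne_zero_of_ne_bot hind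
      exact ⟨f, hf0, P.mul_mem_right _ hf⟩
  choose! f hf0 hf using hex
  refine ⟨∏ P ∈ hfin.toFinset, f P, Finset.prod_ne_zero_iff.mpr fun P hP =>
    hf0 P (hfin.mem_toFinset.mp hP), ?_⟩
  rw [← Ideal.sInf_minimalPrimes, Ideal.mem_sInf]
  intro P hP
  rw [← Finset.mul_prod_erase _ _ (hfin.mem_toFinset.mpr hP), map_mul, mul_right_comm]
  exact P.mul_mem_right _ (hf P hP)

end Geometry

/-! ### Generic subsets of the parameter space. -/

section Generic

variable {μ K : Type*} [Field K]

lemma exists_mem_ne_zero_of_compl_zeroLocus_nonempty {J : Ideal (MvPolynomial μ K)}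
    (h : (zeroLocus K J)ᶜ.Nonempty) : ∃ g ∈ J, g ≠ 0 := by
  obtain ⟨x, hx⟩ := h
  simp only [Set.mem_compl_iff, mem_zeroLocus_iff, not_forall] at hx
  obtain ⟨g, hg, hgx⟩ := hx
  exact ⟨g, hg, fun h => hgx (by simp [h])⟩

/-- A set containing a nonempty open set contains a nonempty principal open set. -/
lemma ContainsOpen.exists_ne_zero {S : Set (μ → K)} (h : ContainsOpen S) :
    ∃ g : MvPolynomial μ K, g ≠ 0 ∧ ∀ x, eval x g ≠ 0 → x ∈ S := by
  obtain ⟨J, hJ, hJS⟩ := h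
  obtain ⟨g, hg, hg0⟩ := exists_mem_ne_zero_of_compl_zeroLocus_nonempty hJ
  exact ⟨g, hg0, fun x hx => hJS fun hxJ => hx (by simpa [aeval_eq_eval] using hxJ g hg)⟩

/-- A constructible set either contains a nonempty open set or lies in a hypersurface. -/
lemma IsConstructibleSet.containsOpen_or_exists {S : Set (μ → K)} (hS : IsConstructibleSet S) :
    ContainsOpen S ∨ ∃ g : MvPolynomial μ K, g ≠ 0 ∧ ∀ x ∈ S, eval x g = 0 := by
  obtain ⟨n, a, b, rfl⟩ := hS
  -- A piece with `a j = ⊥` is open; any other piece lies in the zero set of a nonzero element of `a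
  -- j`.
  by_cases hex : ∃ j, a j = ⊥ ∧ (zeroLocus K (b j))ᶜ.Nonempty
  · obtain ⟨j, ha, hb⟩ := hex
    refine .inl ⟨b j, hb, fun x hx => Set.mem_iUnion.mpr ⟨j, ?_, hx⟩⟩
    simp [ha]
  · have hg : ∀ j, ∃ g : MvPolynomial μ K, g ≠ 0 ∧
        ∀ x ∈ zeroLocus K (a j) \ zeroLocus K (b j), eval x g = 0 := by
      intro j
      by_cases ha : a j = ⊥
      · exact ⟨1, one_ne_zero, fun x hx => (hex ⟨j, ha, x, hx.2⟩).elim⟩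
      · obtain ⟨g, hg, hg0⟩ := Submodule.exists_mem_ne_zero_of_ne_bot ha
        exact ⟨g, hg0, fun x hx => by simpa [aeval_eq_eval] using hx.1 g hg⟩
    choose g hg0 hg using hg
    refine .inr ⟨∏ j, g j, Finset.prod_ne_zero_iff.mpr fun j _ => hg0 j, fun x hx => ?_⟩
    obtain ⟨j, hj⟩ := Set.mem_iUnion.mp hx
    rw [map_prod]
    exact Finset.prod_eq_zero (Finset.mem_univ j) (hg j x hj)

variable [Infinite K]

lemma exists_eval_ne_zero {g : MvPolynomial μ K} (hg : g ≠ 0) : ∃ x, eval x g ≠ 0 := by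
  by_contra! h
  exact hg (MvPolynomial.funext fun x => by simp [h x])

lemma ContainsOpen.not_disjoint {S S' : Set (μ → K)} (h : ContainsOpen S)
    (h' : ContainsOpen S') : ¬ Disjoint S S' := by
  obtain ⟨g, hg, hgS⟩ := h.exists_ne_zero
  obtain ⟨g', hg', hgS'⟩ := h'.exists_ne_zero
  obtain ⟨x, hx⟩ := exists_eval_ne_zero (mul_ne_zero hg hg')
  rw [map_mul] at hx
  exact Set.not_disjoint_iff.mpr
    ⟨x, hgS x (left_ne_zero_of_mul hx), hgS' x (right_ne_zero_of_mul hx)⟩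

lemma exists_containsOpen_of_cover {ι : Type*} [Finite ι] {S : ι → Set (μ → K)}
    (hS : ∀ i, IsConstructibleSet (S i)) (hcover : ⋃ i, S i = Set.univ) :
    ∃ i, ContainsOpen (S i) := by
  have := Fintype.ofFinite ι
  by_contra! hcon
  choose g hg0 hg using fun i => (hS i).containsOpen_or_exists.resolve_left (hcon i)
  obtain ⟨x, hx⟩ := exists_eval_ne_zero
    (Finset.prod_ne_zero_iff.mpr fun i (_ : i ∈ Finset.univ) => hg0 i)
  obtain ⟨i, hi⟩ := Set.mem_iUnion.mp (hcover ▸ Set.mem_univ x)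
  rw [map_prod] at hx
  exact hx (Finset.prod_eq_zero (Finset.mem_univ i) (hg i x hi))

end Generic

/-! ### The reduced Gröbner basis of the unit ideal. -/

section Groebner

variable {ξ K : Type*} [Field K]

/-- The only reduced Gröbner basis of the unit ideal is `{1}`. -/
lemma IsReducedGroebnerBasis.eq_singleton_one {m : MonomialOrder ξ}
    {B : Set (MvPolynomial ξ K)} (hB : IsReducedGroebnerBasis m ⊤ B) : B = {1} := by
  obtain ⟨b, hb, -, hdeg⟩ := hB.isGroebnerBasis.2 1 Submodule.mem_top one_ne_zero
  rw [m.degree_one] at hdeg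
  have hdeg0 : m.degree b = 0 := le_antisymm hdeg bot_le
  have hb1 : b = 1 := by
    rw [m.eq_C_of_degree_eq_zero hdeg0, (hB.monic b hb).leadingCoeff_eq_one, C_1]
  refine Set.eq_singleton_iff_unique_mem.mpr ⟨hb1 ▸ hb, fun b' hb' => ?_⟩
  by_contra hne
  refine hB.reduced b' hb' b hb (hb1 ▸ hne) _ (m.degree_mem_support (hB.monic b' hb').ne_zero) ?_
  rw [hdeg0]
  exact bot_le

end Groebner

/-! ### From a unit specialization to the basis `1`. -/

section Parametric

variable {μ ξ K : Type*} [Field K]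

/-- If the monic specialization of `b` is `1` and its leading coefficient survives, then `b`
has degree zero. -/
lemma degree_eq_zero_of_monicSpecialize_eq_one {m : MonomialOrder ξ} {u₀ : μ → K}
    {b : MvPolynomial ξ (MvPolynomial μ K)} (hb : eval u₀ (m.leadingCoeff b) ≠ 0)
    (h : monicSpecialize m u₀ b = 1) : m.degree b = 0 := by
  classical
  by_contra hdeg
  have hc := congrArg (coeff (m.degree b)) h
  rw [monicSpecialize, specialize, coeff_C_mul, coeff_map, coeff_one, if_neg (Ne.symm hdeg)] at hc
  exact (mul_ne_zero (inv_ne_zero hb) hb) hc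

/-- One point of the segment suffices, because nonvanishing leading coefficients transfer degree
zero from the specialization back to `B i`. -/
lemma IsReducedGroebnerSystem.isBasisOne {m : MonomialOrder ξ}
    {I : Ideal (MvPolynomial ξ (MvPolynomial μ K))} {s : ℕ} {S : Fin s → Set (μ → K)}
    {B : Fin s → Set (MvPolynomial ξ (MvPolynomial μ K))}
    (h : IsReducedGroebnerSystem m I S B) {i : Fin s} {u₀ : μ → K} (hu : u₀ ∈ S i)
    (htop : I.map (specialize u₀) = ⊤) : IsBasisOne (B i) := by
  have himage := (htop ▸ h.reduced i u₀ hu).eq_singleton_one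
  have hdeg : ∀ b ∈ B i, m.degree b = 0 := fun b hb =>
    degree_eq_zero_of_monicSpecialize_eq_one (h.leadingCoeff_ne_zero i u₀ hu b hb)
      (himage ▸ Set.mem_image_of_mem _ hb : monicSpecialize m u₀ b ∈ ({1} : Set _))
  obtain ⟨b, hb⟩ : (B i).Nonempty := by
    rw [← Set.image_nonempty, himage]
    exact Set.singleton_nonempty 1
  have hbC := m.eq_C_of_degree_eq_zero (hdeg b hb)
  -- As `b` has degree zero, its leading coefficient divides all its coefficients.
  have hunit : IsUnit (m.leadingCoeff b) := by
    classical
    refine h.contentOne i b hb _ fun e => ?_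
    rw [hbC, m.leadingCoeff_C, coeff_C]
    split_ifs
    · exact dvd_rfl
    · exact dvd_zero _
  obtain ⟨c, hc, hcb⟩ := MvPolynomial.isUnit_iff_eq_C_of_isReduced.mp hunit
  refine ⟨c, hc.ne_zero, Set.eq_singleton_iff_unique_mem.mpr ?_⟩
  rw [hcb] at hbC
  rw [← hbC]
  exact ⟨hb, fun b' hb' => h.degree_injOn i hb' hb ((hdeg b' hb').trans (hdeg b hb).symm)⟩

end Parametric

/-! ### The Rabinowitsch trick with parameters. -/

section Rabinowitsch

variable {σ K : Type*} [Field K]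

lemma toParametric_rename (U : Set σ) (f : MvPolynomial U K) :
    toParametric U (rename (↑) f) = C f := by
  induction f using MvPolynomial.induction_on with
  | C a => simp [MvPolynomial.algebraMap_eq]
  | add p q hp hq => simp [hp, hq]
  | mul_X p i hp =>
    rw [map_mul, map_mul, hp]
    simp [toParametric]

/-- The point of the specialized variety above `x`: the coordinates of `x` outside `U`, and
the inverse of `T` at `x` for the new variable. -/
noncomputable def rabinowitschPoint (U : Set σ) (T : MvPolynomial σ K) (x : σ → K) :
    Option ↥Uᶜ → K
  | none => (eval x T)⁻¹
  | some i => x i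

/-- The image of `K[X]` does not involve `z`, so the default value `0⁻¹ = 0` is harmless here. -/
lemma eval_specialize_toParametric (U : Set σ) (T : MvPolynomial σ K) (x : σ → K)
    (p : MvPolynomial σ K) :
    eval (rabinowitschPoint U T x) (specialize (fun i : U => x i) (toParametric U p)) =
      eval x p := by
  induction p using MvPolynomial.induction_on with
  | C a => simp [specialize, toParametric]
  | add p q hp hq => simp [hp, hq]
  | mul_X p i hp =>
    by_cases hi : i ∈ U <;> simp [hp] <;> simp [specialize, toParametric, hi, rabinowitschPoint]

lemma eval_eq_zero_of_mem_map_refutationIdeal {U : Set σ} {H : Ideal (MvPolynomial σ K)}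
    {T : MvPolynomial σ K} {x : σ → K} (hx : x ∈ zeroLocus K H) (hT : eval x T ≠ 0)
    {p : MvPolynomial (Option ↥Uᶜ) K}
    (hp : p ∈ (refutationIdeal U H T).map (specialize fun i : U => x i)) :
    eval (rabinowitschPoint U T x) p = 0 := by
  have hle : (refutationIdeal U H T).map (specialize fun i : U => x i) ≤
      RingHom.ker (eval (rabinowitschPoint U T x)) := by
    rw [refutationIdeal, Ideal.map_sup, sup_le_iff, Ideal.map_le_iff_le_comap,
      Ideal.map_le_iff_le_comap, Ideal.map_span, Ideal.span_le]
    constructor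
    · intro q hq
      simpa [RingHom.mem_ker, eval_specialize_toParametric, aeval_eq_eval] using hx q hq
    · rw [Set.image_singleton, Set.singleton_subset_iff, SetLike.mem_coe, RingHom.mem_ker, map_sub,
        map_mul, map_sub, map_mul, eval_specialize_toParametric]
      simp [specialize, rabinowitschPoint, hT]
  exact hle hp

lemma C_mem_refutationIdeal_of_mul_mem_radical {U : Set σ} {H : Ideal (MvPolynomial σ K)}
    {T : MvPolynomial σ K} {f : MvPolynomial U K} (h : rename (↑) f * T ∈ H.radical) :
    ∃ n : ℕ, C (f ^ n) ∈ refutationIdeal U H T := by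
  obtain ⟨n, hn⟩ := h
  refine ⟨n, ?_⟩
  have h1 : C (f ^ n) * toParametric U T ^ n ∈ refutationIdeal U H T := by
    refine le_sup_left (a := H.map (toParametric U)) ?_
    have := Ideal.mem_map_of_mem (toParametric U) hn
    rwa [map_pow, map_mul, toParametric_rename, mul_pow, ← map_pow] at this
  have h2 : (toParametric U T * X none) ^ n - 1 ∈ refutationIdeal U H T := by
    refine le_sup_right (a := H.map (toParametric U)) (Ideal.mem_span_singleton.mpr ?_)
    have := sub_dvd_pow_sub_pow (toParametric U T * X none) 1 n
    rwa [one_pow] at this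
  have h3 := sub_mem (Ideal.mul_mem_right (X none ^ n) _ h1) (Ideal.mul_mem_left _ (C (f ^ n)) h2)
  have heq : C (f ^ n) * toParametric U T ^ n * X none ^ n -
      C (f ^ n) * ((toParametric U T * X none) ^ n - 1) = C (f ^ n) := by
    rw [mul_pow, mul_sub, mul_one, mul_assoc, sub_sub_cancel]
  rwa [heq] at h3

variable [IsAlgClosed K] [Finite σ]

lemma vanishesOnIndependentComponents_iff (U : Set σ) (H : Ideal (MvPolynomial σ K))
    (T : MvPolynomial σ K) :
    VanishesOnIndependentComponents U H T ↔ (refutationIdeal U H T).comap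
      (C : MvPolynomial U K →+* MvPolynomial (Option ↥Uᶜ) (MvPolynomial U K)) ≠ ⊥ := by
  constructor
  · intro h hbot
    obtain ⟨f, hf, hmem⟩ := h.exists_mul_mem_radical
    obtain ⟨n, hn⟩ := C_mem_refutationIdeal_of_mul_mem_radical hmem
    rw [← Ideal.mem_comap, hbot] at hn
    exact pow_ne_zero n hf hn
  · intro h
    obtain ⟨f, hf, hf0⟩ := Submodule.exists_mem_ne_zero_of_ne_bot h
    by_contra hcon
    obtain ⟨x, hx, hxT, hxf⟩ := exists_mem_zeroLocus_of_not_vanishes hcon hf0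
    have := eval_eq_zero_of_mem_map_refutationIdeal hx hxT (Ideal.mem_map_of_mem _ hf)
    exact hxf (by simpa [specialize] using this)

lemma vanishesOnIndependentComponents_iff_isBasisOne {U : Set σ}
    {H : Ideal (MvPolynomial σ K)} {T : MvPolynomial σ K} {m : MonomialOrder (Option ↥Uᶜ)}
    {s : ℕ} {S : Fin s → Set (U → K)}
    {B : Fin s → Set (MvPolynomial (Option ↥Uᶜ) (MvPolynomial U K))}
    (hB : IsReducedGroebnerSystem m (refutationIdeal U H T) S B) {i : Fin s}
    (hi : ContainsOpen (S i)) :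
    VanishesOnIndependentComponents U H T ↔ IsBasisOne (B i) := by
  obtain ⟨g, hg, hgS⟩ := hi.exists_ne_zero
  constructor
  · intro h
    obtain ⟨f, hf, hf0⟩ := Submodule.exists_mem_ne_zero_of_ne_bot
      ((vanishesOnIndependentComponents_iff U H T).mp h)
    -- Here `g ≠ 0` places `u₀` in the segment, and `f ≠ 0` makes the specialization of `f` a unit.
    obtain ⟨u₀, hu₀⟩ := exists_eval_ne_zero (mul_ne_zero hg hf0)
    rw [map_mul] at hu₀
    refine hB.isBasisOne (hgS u₀ (left_ne_zero_of_mul hu₀)) ?_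
    have hmem := Ideal.mem_map_of_mem (specialize u₀) (Ideal.mem_comap.mp hf)
    rw [specialize, map_C] at hmem
    exact Ideal.eq_top_of_isUnit_mem _ hmem ((right_ne_zero_of_mul hu₀).isUnit.map C)
  · rintro ⟨c, hc, hBi⟩
    by_contra hcon
    -- Over the segment the specialized ideal would have a zero, yet it contains the nonzero
    -- constant `c`.
    obtain ⟨x, hx, hxT, hxg⟩ := exists_mem_zeroLocus_of_not_vanishes hcon hg
    have hmem := (hB.groebner i _ (hgS _ hxg)).1 
      (Set.mem_image_of_mem _ (hBi ▸ Set.mem_singleton (C (C c))))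
    have := eval_eq_zero_of_mem_map_refutationIdeal hx hxT hmem
    exact hc (by simpa [specialize] using this)

end Rabinowitsch

end MCCGS

theorem proposition6 {K σ : Type*} [Field K] [IsAlgClosed K] [Finite σ]
    (H : Ideal (MvPolynomial σ K)) (T : MvPolynomial σ K)
    (U : Set σ) (hU : MCCGS.IndependentVars U H)
    (m : MonomialOrder (Option ↥Uᶜ)) :
    (MCCGS.VanishesOnIndependentComponents U H T ↔
      (MCCGS.refutationIdeal U H T).comap
        (C : MvPolynomial U K →+* MvPolynomial (Option ↥Uᶜ) (MvPolynomial U K)) ≠ ⊥) ∧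
    ∀ (s : ℕ) (S : Fin s → Set (U → K))
      (B : Fin s → Set (MvPolynomial (Option ↥Uᶜ) (MvPolynomial U K))),
      MCCGS.IsMCCGS m (MCCGS.refutationIdeal U H T) S B →
        (∃! i, MCCGS.ContainsOpen (S i)) ∧
        ∀ i, MCCGS.ContainsOpen (S i) →
          (MCCGS.VanishesOnIndependentComponents U H T ↔ MCCGS.IsBasisOne (B i)) := by
  refine ⟨MCCGS.vanishesOnIndependentComponents_iff U H T, fun s S B hB => ⟨?_, fun i hi =>
    MCCGS.vanishesOnIndependentComponents_iff_isBasisOne hB.toIsReducedGroebnerSystem hi⟩⟩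
  obtain ⟨i, hi⟩ := MCCGS.exists_containsOpen_of_cover hB.constructible hB.cover
  refine ⟨i, hi, fun j hj => ?_⟩
  by_contra hne
  exact hj.not_disjoint hi (hB.disjoint hne)
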